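/- Let $\mathbb F$ be an algebraically closed field of characteristic zero and fix $\iota\in\mathbb F$ with $\iota^2=-1$. Let $x$ be an even and $\xi_1,\dots,\xi_6$ odd indeterminates, and let $K(1,6)$ be the Lie superalgebra with underlying space $\mathbb F[[x]]\otimes\Lambda(\xi_1,\dots,\xi_6)$ and contact bracket $$[f,g]=\Big(2f-\sum_{i=1}^6\xi_i\partial_i f\Big)\partial_x g-(-1)^{|f||g|}\Big(2g-\sum_{i=1}^6\xi_i\partial_i g\Big)\partial_x f+(-1)^{|f|}\sum_{i=1}^6\partial_i f\,\partial_i g ,$$ with the principal $\mathbb Z$-gradation in which $x^n\xi_{i_1}\cdots\xi_{i_d}$ (distinct indices) has degree $2n+d-2$. For a monomial $\xi_I$ in the $\xi_i$ let $\xi_I^*$ be its Hodge dual, i.e. $\pm$ the complementary monomial with $\xi_I\xi_I^*=\xi_1\cdots\xi_6$. Let $E(1,6)\subset K(1,6)$ be the subsuperalgebra spanned by the elements $$a\,\xi_I-\iota(-1)^{d(d+1)/2}\,\partial_x^{3-d}(a)\,\xi_I^*,\qquad a\in\mathbb F[[x]],\ d=|I|\le 3,$$ with the induced gradation (linearly compact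 form), or its $\mathbb Z$-graded form, in which $\mathbb F[[x]]$ is replaced by $\mathbb F[x]$; the following holds for both. A Hom-Lie superalgebra structure on a Lie superalgebra $\mathfrak g$ is an even linear map $\sigma:\mathfrak g\to\mathfrak g$ with $\sigma[y,z]=[\sigma y,\sigma z]$ and $$(-1)^{|u||z|}[\sigma(u),[y,z]]+(-1)^{|y||u|}[\sigma(y),[z,u]]+(-1)^{|z||y|}[\sigma(z),[u,y]]=0$$ for all homogeneous $u,y,z\in\mathfrak g$. Let $\sigma\neq 0$ be a Hom-Lie superalgebra structure on $E(1,6)$. Then 1. $E(1,6)_{-1}=\langle\xi_1,\dots,\xi_6\rangle$ and $\sigma$ is the identity on $E(1,6)_{-1}$; 2. $E(1,6)_{0}=\langle x,\ \xi_i\xi_j \mid 1\le i\ne j\le 6\rangle$ and $\sigma$ is the identity on $E(1,6)_{0}$. -/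

import Mathlib

open scoped PowerSeries

/-- The Grassmann superalgebra `F⟦x⟧ ⊗ Λ(ξ₁,…,ξ₆)`.  The element `∑ I, f I · ξ_I` is the family
`I ↦ f I`, where `ξ_I` is the product of the `ξ_i`, `i ∈ I`, in increasing order. -/
abbrev Grass (F : Type*) [Field F] : Type _ := Finset (Fin 6) → F⟦X⟧

namespace Grass

/-- The sign with `ξ_I ξ_J = sgn I J · ξ_{I ∪ J}` for disjoint `I`, `J`. -/
def sgn (I J : Finset (Fin 6)) : ℤ := (-1) ^ ((I ×ˢ J).filter fun p => p.2 < p.1).card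

variable {F : Type*} [Field F]

/-- The associative product. -/
noncomputable def mul : Grass F →ₗ[F] Grass F →ₗ[F] Grass F :=
  LinearMap.mk₂ F
    (fun f g K => ∑ I ∈ K.powerset, sgn I (K \ I) • (f I * g (K \ I)))
    (fun f₁ f₂ g => by
      funext K; simp [add_mul, smul_add, Finset.sum_add_distrib])
    (fun c f g => by
      funext K; simp [Finset.smul_sum])
    (fun f g₁ g₂ => by
      funext K; simp [mul_add, smul_add, Finset.sum_add_distrib])
    (fun c f g => by
      funext K; simp [Finset.smul_sum])

/-- The even derivation `∂ₓ`. -/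
noncomputable def dx : Grass F →ₗ[F] Grass F :=
  LinearMap.pi fun K => (PowerSeries.derivative F).toLinearMap ∘ₗ LinearMap.proj K

/-- The odd derivation `∂ᵢ = ∂/∂ξᵢ`: it sends `ξᵢ ξ_K` to `ξ_K` if `i ∉ K`, and kills `ξ_K`. -/
noncomputable def dxi (i : Fin 6) : Grass F →ₗ[F] Grass F :=
  LinearMap.pi fun K => if i ∈ K then 0 else sgn {i} K • LinearMap.proj (insert i K)

/-- The monomial `a(x) ξ_I`. -/
noncomputable def mono (I : Finset (Fin 6)) (a : F⟦X⟧) : Grass F := Pi.single I a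

/-- The odd indeterminate `ξᵢ`. -/
noncomputable def xi (i : Fin 6) : Grass F := mono {i} 1

/-- The operator `∑ᵢ ξᵢ ∂ᵢ`. -/
noncomputable def euler : Grass F →ₗ[F] Grass F := ∑ i, mul (xi i) ∘ₗ dxi i

/-- The parity involution `f ↦ (-1)^{|f|} f`. -/
noncomputable def sign : Grass F →ₗ[F] Grass F :=
  LinearMap.pi fun K => ((-1 : ℤ) ^ K.card) • LinearMap.proj K

/-- The contact bracket of `K(1,6)`.  For homogeneous `f`, `g` it reads
`[f, g] = (2f - ∑ ξᵢ∂ᵢf) ∂ₓg - (-1)^{|f||g|} (2g - ∑ ξᵢ∂ᵢg) ∂ₓf + (-1)^{|f|} ∑ ∂ᵢf ∂ᵢg`; in the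
second term the factors are interchanged here, which absorbs the sign `(-1)^{|f||g|}`. -/
noncomputable def bracket : Grass F →ₗ[F] Grass F →ₗ[F] Grass F :=
  mul.compl₁₂ ((2 : F) • LinearMap.id - euler) dx - mul.compl₁₂ dx ((2 : F) • LinearMap.id - euler)
    + ∑ i, mul.compl₁₂ (dxi i ∘ₗ sign) (dxi i)

/-- The scalar with `-ι · (-1)^{d(d+1)/2} ξ_I^* = coef ι I · ξ_{Iᶜ}`, where `d = |I|` and `ξ_I^*` is
the Hodge dual of `ξ_I`: the multiple of `ξ_{Iᶜ}` with `ξ_I ξ_I^* = ξ₁ξ₂ξ₃ξ₄ξ₅ξ₆`. -/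
noncomputable def coef (ι : F) (I : Finset (Fin 6)) : F :=
  -ι * (-1) ^ (I.card * (I.card + 1) / 2) * (sgn I Iᶜ : F)

/-- The underlying space of `E(1,6) ⊆ K(1,6)`, where `ι² = -1`: the span (over all power series
`a` and all `I` with `d = |I| ≤ 3`) of the elements
`a ξ_I - ι (-1)^{d(d+1)/2} ∂ₓ^{3-d}(a) ξ_I^*`, written through the components. -/
def E16Space (ι : F) : Submodule F (Grass F) where
  carrier := {f | ∀ I : Finset (Fin 6), I.card ≤ 3 →
    f Iᶜ = coef ι I • (PowerSeries.derivative F)^[3 - I.card] (f I)}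
  add_mem' := by
    intro f g hf hg I hI
    simp only [Pi.add_apply, hf I hI, hg I hI, iterate_map_add, smul_add]
  zero_mem' := by
    intro I hI
    simp [iterate_map_zero]
  smul_mem' := by
    intro c f hf I hI
    have : ∀ n (a : F⟦X⟧), (PowerSeries.derivative F)^[n] (c • a) =
        c • (PowerSeries.derivative F)^[n] a := by
      intro n
      induction n with
      | zero => simp
      | succ n ih => intro a; simp [Function.iterate_succ_apply, ih]
    simp only [Pi.smul_apply, hf I hI, this, smul_comm c]

/-- The elements of parity `a`, where `|x| = 0` and `|ξᵢ| = 1`. -/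
def parityPart (a : ZMod 2) : Submodule F (Grass F) where
  carrier := {f | ∀ I : Finset (Fin 6), (I.card : ZMod 2) ≠ a → f I = 0}
  add_mem' := by
    intro f g hf hg I hI
    simp [hf I hI, hg I hI]
  zero_mem' := by simp
  smul_mem' := by
    intro c f hf I hI
    simp [hf I hI]

/-- The component of degree `j` of the principal gradation: `xⁿ ξ_I` has degree `2n + |I| - 2`. -/
def degPart (j : ℤ) : Submodule F (Grass F) where
  carrier := {f | ∀ (I : Finset (Fin 6)) (n : ℕ), 2 * (n : ℤ) + I.card - 2 ≠ j →
    PowerSeries.coeff n (f I) = 0}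
  add_mem' := by
    intro f g hf hg I n h
    simp [hf I n h, hg I n h]
  zero_mem' := by simp
  smul_mem' := by
    intro c f hf I n h
    simp [hf I n h]

/-- The elements all of whose components are polynomials in `x`. -/
def polyPart : Submodule F (Grass F) where
  carrier := {f | ∀ I, f I ∈ (Polynomial.coeToPowerSeries.ringHom (R := F)).range}
  add_mem' := fun hf hg I => add_mem (hf I) (hg I)
  zero_mem' := fun _ => zero_mem _
  smul_mem' := by
    intro c f hf I
    obtain ⟨P, hP⟩ := hf I
    refine ⟨c • P, ?_⟩
    simp only [Polynomial.coeToPowerSeries.ringHom_apply] at hP ⊢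
    rw [Pi.smul_apply, ← hP, Polynomial.coe_smul]

theorem mul_apply (f g : Grass F) (K : Finset (Fin 6)) :
    mul f g K = ∑ I ∈ K.powerset, sgn I (K \ I) • (f I * g (K \ I)) := rfl

theorem dx_apply (f : Grass F) (K) : dx f K = PowerSeries.derivative F (f K) := rfl

theorem dxi_apply (i : Fin 6) (f : Grass F) (K : Finset (Fin 6)) :
    dxi i f K = if i ∈ K then 0 else sgn {i} K • f (insert i K) := by
  by_cases h : i ∈ K <;> simp [dxi, h]

theorem sgn_mul_self (I J) : sgn I J * sgn I J = 1 := by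
  simp [sgn, ← mul_pow]

theorem euler_apply (f : Grass F) (K : Finset (Fin 6)) : euler f K = K.card • f K := by
  have h : ∀ i : Fin 6, mul (xi i) (dxi i f) K = if i ∈ K then f K else 0 := by
    intro i
    rw [mul_apply]
    by_cases hi : i ∈ K
    · rw [Finset.sum_eq_single {i}]
      · simp only [xi, mono, dxi_apply, Pi.single_eq_same, one_mul, Finset.mem_sdiff,
          Finset.mem_singleton, not_true_eq_false, and_false, if_false, smul_smul, sgn_mul_self,
          one_smul, Finset.insert_sdiff_self_of_mem hi, if_pos hi]
      · intro I _ hI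
        simp [xi, mono, Pi.single_eq_of_ne hI]
      · simp [hi]
    · rw [if_neg hi]
      refine Finset.sum_eq_zero fun I hI => ?_
      have : I ≠ {i} := by
        rintro rfl
        simp at hI
        exact hi hI
      simp [xi, mono, Pi.single_eq_of_ne this]
  simp [euler, h]


/-- The part of the component `K` of `[f, g]` that comes from `f I` and `g J`, where `A = I ∩ J`,
`C = I \ J`, `D = J \ I`. -/
noncomputable def tau (A C D : Finset (Fin 6)) (f g : Grass F) : F⟦X⟧ :=
  if A.card = 0 then
    sgn C D • ((2 - (C.card : ℤ)) • (f (A ∪ C) * PowerSeries.derivative F (g (A ∪ D))) -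
        (2 - (D.card : ℤ)) • (PowerSeries.derivative F (f (A ∪ C)) * g (A ∪ D)))
  else if A.card = 1 then
    (sgn C D * (sgn A C * sgn A D * (-1) ^ (C.card + 1))) • (f (A ∪ C) * g (A ∪ D))
  else 0

theorem sum_powerset_tau (C D S : Finset (Fin 6)) (f g : Grass F) :
    ∑ A ∈ S.powerset, tau A C D f g = tau ∅ C D f g + ∑ i ∈ S, tau {i} C D f g := by
  have h : insert ∅ (S.image fun i => ({i} : Finset (Fin 6))) ⊆ S.powerset := by
    intro A hA
    simp only [Finset.mem_insert, Finset.mem_image] at hA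
    rcases hA with rfl | ⟨i, hi, rfl⟩ <;> simp [*]
  rw [← Finset.sum_subset h, Finset.sum_insert (by simp),
    Finset.sum_image (by intro a _ b _ h; simpa using h)]
  intro A hA hA'
  have h0 : A.card ≠ 0 := by
    intro h0
    exact hA' (by simp [Finset.card_eq_zero.mp h0])
  have h1 : A.card ≠ 1 := by
    intro h1
    obtain ⟨i, rfl⟩ := Finset.card_eq_one.mp h1
    exact hA' (by simpa using hA)
  simp [tau, h0, h1]

theorem bracket_apply (f g : Grass F) (K : Finset (Fin 6)) :
    bracket f g K = ∑ I, tau (I \ K) (I ∩ K) (K \ I) f g := by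
  have h1 : ∑ I, tau (I \ K) (I ∩ K) (K \ I) f g =
      ∑ C ∈ K.powerset, ∑ A ∈ Kᶜ.powerset, tau A C (K \ C) f g := by
    rw [← Finset.sum_product']
    refine Finset.sum_bij' (fun I _ => (I ∩ K, I \ K)) (fun p _ => p.1 ∪ p.2) ?_ ?_ ?_ ?_ ?_
    · intro I _
      simp only [Finset.mem_product, Finset.mem_powerset]
      constructor <;> intro x <;> simp
    · simp
    · intro I _
      ext x
      simp only [Finset.mem_union, Finset.mem_inter, Finset.mem_sdiff]
      tauto
    · rintro ⟨C, A⟩ hp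
      simp only [Finset.mem_product, Finset.mem_powerset, Finset.subset_iff,
        Finset.mem_compl] at hp
      obtain ⟨hC, hA⟩ := hp
      simp only [Prod.mk.injEq]
      constructor <;> ext x <;>
        simp only [Finset.mem_union, Finset.mem_inter, Finset.mem_sdiff] <;>
        have := @hC x <;> have := @hA x <;> tauto
    · intro I _
      congr 1
      ext x
      simp
  have h2 : ∀ i, mul (dxi i (sign f)) (dxi i g) K = if i ∈ Kᶜ then
      ∑ C ∈ K.powerset, tau {i} C (K \ C) f g else 0 := by
    intro i
    rw [mul_apply]
    split_ifs with hi
    · refine Finset.sum_congr rfl fun C hC => ?_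
      rw [Finset.mem_compl] at hi
      have hiC : i ∉ C := fun h => hi (Finset.mem_powerset.mp hC h)
      simp only [dxi_apply, hiC, if_false, Finset.mem_sdiff, hi, false_and, tau,
        Finset.card_singleton, one_ne_zero, if_true, sign, LinearMap.pi_apply,
        LinearMap.smul_apply, LinearMap.proj_apply, Finset.card_insert_of_notMem hiC,
        zsmul_eq_mul, ← Finset.insert_eq]
      push_cast
      ring
    · rw [Finset.mem_compl, not_not] at hi
      refine Finset.sum_eq_zero fun C hC => ?_
      by_cases hiC : i ∈ C
      · simp [dxi_apply, hiC]
      · have : i ∈ K \ C := Finset.mem_sdiff.mpr ⟨hi, hiC⟩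
        simp [dxi_apply, hiC, this]
  rw [h1]
  simp_rw [sum_powerset_tau]
  rw [Finset.sum_add_distrib, Finset.sum_comm (s := K.powerset)]
  simp only [bracket, LinearMap.add_apply, LinearMap.sub_apply, LinearMap.sum_apply,
    LinearMap.compl₁₂_apply, LinearMap.comp_apply, Pi.add_apply, Pi.sub_apply, Finset.sum_apply,
    h2, Finset.sum_ite_mem, Finset.univ_inter]
  congr 1
  have h3 : ∀ a : F⟦X⟧, (2 : F) • a = 2 * a := fun a => by rw [two_smul, two_mul]
  rw [mul_apply, mul_apply, ← Finset.sum_sub_distrib]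
  refine Finset.sum_congr rfl fun C hC => ?_
  simp only [tau, Finset.card_empty, if_true, Finset.empty_union, LinearMap.smul_apply,
    LinearMap.id_apply, Pi.sub_apply, Pi.smul_apply, euler_apply, dx_apply, zsmul_eq_mul,
    nsmul_eq_mul, h3]
  push_cast
  ring

theorem sgn_union_left {I J K : Finset (Fin 6)} (h : Disjoint I J) :
    sgn (I ∪ J) K = sgn I K * sgn J K := by
  unfold sgn
  rw [← pow_add, Finset.union_product, Finset.filter_union, Finset.card_union_of_disjoint]
  apply Finset.disjoint_filter_filter
  rw [Finset.disjoint_product]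
  exact Or.inl h

theorem sgn_union_right {I J K : Finset (Fin 6)} (h : Disjoint J K) :
    sgn I (J ∪ K) = sgn I J * sgn I K := by
  unfold sgn
  rw [← pow_add, Finset.product_union, Finset.filter_union, Finset.card_union_of_disjoint]
  apply Finset.disjoint_filter_filter
  rw [Finset.disjoint_product]
  exact Or.inr h

theorem sgn_comm {I J : Finset (Fin 6)} (h : Disjoint I J) :
    sgn J I = (-1) ^ (I.card * J.card) * sgn I J := by
  have key : ((I ×ˢ J).filter fun p => p.2 < p.1).card + ((J ×ˢ I).filter fun p => p.2 < p.1).card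
      = I.card * J.card := by
    rw [← Finset.card_product, ← Finset.card_filter_add_card_filter_not (s := I ×ˢ J)
      (fun p => p.2 < p.1)]
    congr 1
    refine Finset.card_bij (fun p _ => p.swap) ?_ ?_ ?_
    · rintro ⟨a, b⟩ hp
      simp only [Finset.mem_filter, Finset.mem_product, Prod.swap] at hp ⊢
      exact ⟨⟨hp.1.2, hp.1.1⟩, by simpa using hp.2.le⟩
    · rintro ⟨a, b⟩ _ ⟨c, d⟩ _ h
      simpa [Prod.ext_iff, and_comm] using h
    · rintro ⟨a, b⟩ hp
      simp only [Finset.mem_filter, Finset.mem_product] at hp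
      refine ⟨(b, a), ?_, rfl⟩
      simp only [Finset.mem_filter, Finset.mem_product]
      refine ⟨⟨hp.1.2, hp.1.1⟩, lt_of_le_of_ne (not_lt.mp hp.2) ?_⟩
      rintro rfl
      exact (Finset.disjoint_left.mp h hp.1.1) hp.1.2
  unfold sgn
  rw [← key, pow_add, mul_comm, ← mul_assoc, ← mul_pow]
  simp

theorem sgn_card_zero_left {I J : Finset (Fin 6)} (h : I.card = 0) : sgn I J = 1 := by
  rw [Finset.card_eq_zero] at h
  simp [sgn, h]

theorem sgn_sq (I J : Finset (Fin 6)) : sgn I J ^ 2 = 1 := by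
  rw [sq, sgn_mul_self]

theorem sgn_card_zero_right {I J : Finset (Fin 6)} (h : J.card = 0) : sgn I J = 1 := by
  rw [Finset.card_eq_zero] at h
  simp [sgn, h]

/-- `tau` in terms of cardinalities, signs and components. -/
def tauAux {F R : Type*} [Field F] [CommRing R] [Algebra F R] (δ : Derivation F R R)
    (a c d : ℕ) (w q r : ℤ) (x y : R) : R :=
  if a = 0 then w • ((2 - (c : ℤ)) • (x * δ y) - (2 - (d : ℤ)) • (δ x * y))
  else if a = 1 then (w * (q * r * (-1) ^ (c + 1))) • (x * y) else 0

set_option maxHeartbeats 4000000 in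
theorem tauAux_eq {F R : Type*} [Field F] [CommRing R] [Algebra F R] (δ : Derivation F R R)
    {ι : F} (hι : ι ^ 2 = -1) (u u' v v' : R) (a b c d : ℕ) (hs : a + b + c + d = 6)
    (hk : c + d ≤ 3) (hab : a ≤ b) (p q r s t w : ℤ)
    (hp : p ^ 2 = 1) (hq : q ^ 2 = 1) (hr : r ^ 2 = 1)
    (hs' : s ^ 2 = 1) (ht : t ^ 2 = 1) (hw : w ^ 2 = 1)
    (ha0 : a = 0 → p = 1 ∧ q = 1 ∧ r = 1) (hc0 : c = 0 → q = 1 ∧ s = 1 ∧ w = 1)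
    (hd0 : d = 0 → r = 1 ∧ t = 1 ∧ w = 1)
    (hu : a + c ≤ 3 → u' = (-ι * (-1) ^ ((a + c) * (a + c + 1) / 2) *
      (((p * r) * (((-1) ^ (b * c) * s) * w) : ℤ) : F)) • δ^[3 - (a + c)] u)
    (hu' : b + d ≤ 3 → u = (-ι * (-1) ^ ((b + d) * (b + d + 1) / 2) *
      (((((-1) ^ (a * b) * p) * s) * (((-1) ^ (a * d) * r) * ((-1) ^ (c * d) * w)) : ℤ) : F)) •
        δ^[3 - (b + d)] u')
    (hv : a + d ≤ 3 → v' = (-ι * (-1) ^ ((a + d) * (a + d + 1) / 2) *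
      (((p * q) * (((-1) ^ (b * d) * t) * ((-1) ^ (c * d) * w)) : ℤ) : F)) • δ^[3 - (a + d)] v)
    (hv' : b + c ≤ 3 → v = (-ι * (-1) ^ ((b + c) * (b + c + 1) / 2) *
      (((((-1) ^ (a * b) * p) * t) * (((-1) ^ (a * c) * q) * w) : ℤ) : F)) • δ^[3 - (b + c)] v') :
    tauAux δ c a b p ((-1) ^ (a * c) * q) ((-1) ^ (b * c) * s) u v' +
      tauAux δ d b a ((-1) ^ (a * b) * p) ((-1) ^ (b * d) * t) ((-1) ^ (a * d) * r) u' v =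
    (-ι * (-1) ^ ((c + d) * (c + d + 1) / 2) * (((((-1) ^ (a * c) * q) * ((-1) ^ (b * c) * s)) *
      (((-1) ^ (a * d) * r) * ((-1) ^ (b * d) * t)) : ℤ) : F)) • δ^[3 - (c + d)]
      (tauAux δ a c d w q r u v + tauAux δ b d c ((-1) ^ (c * d) * w) t s u' v') := by
  have hj : (algebraMap F R ι) ^ 2 = -1 := by rw [← map_pow, hι]; simp
  have hj' : δ (algebraMap F R ι) = 0 := δ.map_algebraMap ι
  replace hp : (p : R) ^ 2 = 1 := by exact_mod_cast congrArg (Int.cast : ℤ → R) hp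
  replace hq : (q : R) ^ 2 = 1 := by exact_mod_cast congrArg (Int.cast : ℤ → R) hq
  replace hr : (r : R) ^ 2 = 1 := by exact_mod_cast congrArg (Int.cast : ℤ → R) hr
  replace hs' : (s : R) ^ 2 = 1 := by exact_mod_cast congrArg (Int.cast : ℤ → R) hs'
  replace ht : (t : R) ^ 2 = 1 := by exact_mod_cast congrArg (Int.cast : ℤ → R) ht
  replace hw : (w : R) ^ 2 = 1 := by exact_mod_cast congrArg (Int.cast : ℤ → R) hw
  have hP : δ (p : R) = 0 := δ.map_intCast p
  have hQ : δ (q : R) = 0 := δ.map_intCast q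
  have hR : δ (r : R) = 0 := δ.map_intCast r
  have hS : δ (s : R) = 0 := δ.map_intCast s
  have hT : δ (t : R) = 0 := δ.map_intCast t
  have hW : δ (w : R) = 0 := δ.map_intCast w
  have h2 : δ (2 : R) = 0 := by exact_mod_cast δ.map_natCast 2
  have hc : c ≤ 3 := by omega
  have hd : d ≤ 3 := by omega
  have ha : a ≤ 3 := by omega
  obtain rfl : b = 6 - a - c - d := by omega
  interval_cases c <;> interval_cases d <;> first | omega | skip
  all_goals interval_cases a <;> first | omega | skip
  all_goals
    simp only [forall_const, Nat.reduceAdd, Nat.reduceLeDiff, Nat.reduceSub, Nat.reduceMul,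
      Nat.reduceDiv, false_implies, one_ne_zero, OfNat.ofNat_ne_zero, le_refl,
      Function.iterate_succ_apply, Function.iterate_zero_apply] at ha0 hc0 hd0 hu hu' hv hv' ⊢
  all_goals first | subst hu | subst hu'
  all_goals first | subst hv | subst hv'
  all_goals
    simp [tauAux, Algebra.smul_def, Derivation.leibniz, hj', hP, hQ, hR, hS, hT, hW, h2]
  all_goals grind

theorem tau_eq (A C D : Finset (Fin 6)) (f g : Grass F) :
    tau A C D f g = tauAux (PowerSeries.derivative F) A.card C.card D.card (sgn C D) (sgn A C)
      (sgn A D) (f (A ∪ C)) (g (A ∪ D)) := rfl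

theorem core {ι : F} (hι : ι ^ 2 = -1) {f g : Grass F} (hf : f ∈ E16Space ι) (hg : g ∈ E16Space ι)
    {A B C D : Finset (Fin 6)} (hAB : Disjoint A B) (hAC : Disjoint A C) (hAD : Disjoint A D)
    (hBC : Disjoint B C) (hBD : Disjoint B D) (hCD : Disjoint C D)
    (hU : A ∪ B ∪ C ∪ D = Finset.univ) (hk : C.card + D.card ≤ 3) (hab : A.card ≤ B.card) :
    tau C A B f g + tau D B A f g =
      coef ι (C ∪ D) • (PowerSeries.derivative F)^[3 - (C ∪ D).card]
        (tau A C D f g + tau B D C f g) := by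
  have hmem : ∀ x, x ∈ A ∨ x ∈ B ∨ x ∈ C ∨ x ∈ D := by
    intro x
    have : x ∈ A ∪ B ∪ C ∪ D := hU ▸ Finset.mem_univ x
    simpa [or_assoc] using this
  have hcompl : ∀ {S T : Finset (Fin 6)}, Disjoint S T → (∀ x, x ∈ S ∨ x ∈ T) → Sᶜ = T := by
    intro S T hd hc
    ext x
    have h1 := hc x
    have h2 : x ∈ S → x ∉ T := fun h => Finset.disjoint_left.mp hd h
    rw [Finset.mem_compl]
    exact ⟨h1.resolve_left, fun h h' => h2 h' h⟩
  have hsum : A.card + B.card + C.card + D.card = 6 := by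
    rw [← Finset.card_union_of_disjoint hAB, ← Finset.card_union_of_disjoint,
      ← Finset.card_union_of_disjoint, hU]
    · simp
    · simp [Finset.disjoint_union_left, *]
    · simp [Finset.disjoint_union_left, *]
  have hI : (A ∪ C)ᶜ = B ∪ D := hcompl
    (by simp [Finset.disjoint_union_left, Finset.disjoint_union_right, hAB, hAD, hBC.symm, hCD])
    (fun x => by rcases hmem x with h | h | h | h <;> simp [h])
  have hJ : (A ∪ D)ᶜ = B ∪ C := hcompl
    (by simp [Finset.disjoint_union_left, Finset.disjoint_union_right, hAB, hAC, hBD.symm,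
      hCD.symm])
    (fun x => by rcases hmem x with h | h | h | h <;> simp [h])
  have hK : (C ∪ D)ᶜ = A ∪ B := hcompl
    (by simp [Finset.disjoint_union_left, Finset.disjoint_union_right, hAC.symm, hBC.symm,
      hAD.symm, hBD.symm])
    (fun x => by rcases hmem x with h | h | h | h <;> simp [h])
  have hI' : (B ∪ D)ᶜ = A ∪ C := by rw [← hI, compl_compl]
  have hJ' : (B ∪ C)ᶜ = A ∪ D := by rw [← hJ, compl_compl]
  have cI := Finset.card_union_of_disjoint hAC
  have cI' := Finset.card_union_of_disjoint hBD
  have cJ := Finset.card_union_of_disjoint hAD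
  have cJ' := Finset.card_union_of_disjoint hBC
  have cK := Finset.card_union_of_disjoint hCD
  have sU : ∀ {P Q S T : Finset (Fin 6)}, Disjoint P Q → Disjoint S T →
      sgn (P ∪ Q) (S ∪ T) = (sgn P S * sgn P T) * (sgn Q S * sgn Q T) := by
    intro P Q S T h1 h2
    rw [sgn_union_left h1, sgn_union_right h2, sgn_union_right h2]
  have sI := sU hAC hBD
  rw [sgn_comm hBC] at sI
  have sI' := sU hBD hAC
  rw [sgn_comm hAB, sgn_comm hAD, sgn_comm hCD] at sI'
  have sJ := sU hAD hBC
  rw [sgn_comm hBD, sgn_comm hCD] at sJ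
  have sJ' := sU hBC hAD
  rw [sgn_comm hAB, sgn_comm hAC] at sJ'
  have sK := sU hCD hAB
  rw [sgn_comm hAC, sgn_comm hAD, sgn_comm hBC, sgn_comm hBD] at sK
  have hu := hf (A ∪ C)
  rw [coef, hI, cI, sI] at hu
  have hu' := hf (B ∪ D)
  rw [coef, hI', cI', sI'] at hu'
  have hv := hg (A ∪ D)
  rw [coef, hJ, cJ, sJ] at hv
  have hv' := hg (B ∪ C)
  rw [coef, hJ', cJ', sJ'] at hv'
  have key := tauAux_eq (PowerSeries.derivative F) hι (f (A ∪ C)) (f (B ∪ D)) (g (A ∪ D))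
    (g (B ∪ C)) A.card B.card C.card D.card hsum hk hab (sgn A B) (sgn A C) (sgn A D) (sgn B C)
    (sgn B D) (sgn C D)
    (sgn_sq _ _) (sgn_sq _ _) (sgn_sq _ _) (sgn_sq _ _) (sgn_sq _ _) (sgn_sq _ _)
    (fun h => ⟨sgn_card_zero_left h, sgn_card_zero_left h, sgn_card_zero_left h⟩)
    (fun h => ⟨sgn_card_zero_right h, sgn_card_zero_right h, sgn_card_zero_left h⟩)
    (fun h => ⟨sgn_card_zero_right h, sgn_card_zero_right h, sgn_card_zero_right h⟩)
    hu hu' hv hv'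
  rw [tau_eq, tau_eq, tau_eq, tau_eq, coef, hK, cK, sK, Finset.union_comm C A,
    Finset.union_comm C B, Finset.union_comm D B, Finset.union_comm D A, sgn_comm hAB,
    sgn_comm hAC, sgn_comm hAD, sgn_comm hBC, sgn_comm hBD, sgn_comm hCD]
  exact key

theorem set_facts (I K : Finset (Fin 6)) :
    (Iᶜ \ Kᶜ = K \ I ∧ Iᶜ \ K = Kᶜ \ I ∧ I \ Kᶜ = I ∩ K ∧ Iᶜ ∩ K = K \ I ∧ K \ Iᶜ = I ∩ K ∧
      I ∩ Kᶜ = I \ K ∧ Iᶜ ∩ Kᶜ = Kᶜ \ I ∧ Kᶜ \ Iᶜ = I \ K) ∧ (I ∩ K) ∪ (K \ I) = K ∧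
    Disjoint (I \ K) (Kᶜ \ I) ∧ Disjoint (I \ K) (I ∩ K) ∧ Disjoint (I \ K) (K \ I) ∧
    Disjoint (Kᶜ \ I) (I ∩ K) ∧ Disjoint (Kᶜ \ I) (K \ I) ∧ Disjoint (I ∩ K) (K \ I) ∧
    (I \ K) ∪ (Kᶜ \ I) ∪ (I ∩ K) ∪ (K \ I) = Finset.univ := by
  simp only [Finset.disjoint_left, Finset.ext_iff, Finset.mem_union, Finset.mem_inter,
    Finset.mem_sdiff, Finset.mem_compl, Finset.mem_univ, iff_true]
  refine ⟨⟨?_, ?_, ?_, ?_, ?_, ?_, ?_, ?_⟩, ?_, ?_, ?_, ?_, ?_, ?_, ?_, ?_⟩ <;> intro x <;> tauto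

theorem bracket_mem [CharZero F] {ι : F} (hι : ι ^ 2 = -1) {f g : Grass F} (hf : f ∈ E16Space ι)
    (hg : g ∈ E16Space ι) : bracket f g ∈ E16Space ι := by
  intro K hK
  rw [bracket_apply, bracket_apply]
  have hD : ∀ n (a b : F⟦X⟧), (PowerSeries.derivative F)^[n] (a + b) =
      (PowerSeries.derivative F)^[n] a + (PowerSeries.derivative F)^[n] b :=
    fun n a b => iterate_map_add _ _ _ _
  have hdouble : ∀ h : Finset (Fin 6) → F⟦X⟧, ∑ I, (h I + h Iᶜ) = (2 : F⟦X⟧) * ∑ I, h I := by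
    intro h
    rw [Finset.sum_add_distrib, two_mul]
    congr 1
    exact Equiv.sum_comp (Equiv.ofBijective _ (compl_bijective (α := Finset (Fin 6)))) h
  have h2 : (2 : F) ≠ 0 := two_ne_zero
  have h3 : ∀ a : F⟦X⟧, (2 : F) • a = 2 * a := fun a => by rw [two_smul, two_mul]
  have hit : ∀ n (a : F⟦X⟧), (2 : F) • (PowerSeries.derivative F)^[n] a =
      (PowerSeries.derivative F)^[n] ((2 : F) • a) := by
    intro n a
    rw [two_smul, two_smul, hD]
  have hsumD : ∀ n (h : Finset (Fin 6) → F⟦X⟧), (PowerSeries.derivative F)^[n] (∑ I, h I) =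
      ∑ I, (PowerSeries.derivative F)^[n] (h I) := by
    intro n h
    induction n with
    | zero => rfl
    | succ n ih => simp only [Function.iterate_succ_apply', ih, map_sum]
  refine smul_right_injective _ h2 ?_
  show (2 : F) • _ = (2 : F) • _
  rw [smul_comm (2 : F) (coef ι K), hit, h3, h3, ← hdouble, ← hdouble, hsumD, Finset.smul_sum]
  refine Finset.sum_congr rfl fun I _ => ?_
  obtain ⟨⟨e1, e2, e3, e4, e5, e6, e7, e8⟩, eK, hAB, hAC, hAD, hBC, hBD, hCD, hU⟩ :=
    set_facts I K
  have cK : (I ∩ K).card + (K \ I).card = K.card := by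
    rw [← Finset.card_union_of_disjoint hCD, eK]
  rw [e1, e2, e3, e4, e5, e6, e7, e8]
  rcases le_total (I \ K).card (Kᶜ \ I).card with hab | hab
  · have h := core hι hf hg hAB hAC hAD hBC hBD hCD hU (by omega) hab
    rw [eK] at h
    exact h
  · have hU' : (Kᶜ \ I) ∪ (I \ K) ∪ (K \ I) ∪ (I ∩ K) = Finset.univ := by
      rw [Finset.union_comm (Kᶜ \ I), Finset.union_right_comm, hU]
    have h := core hι hf hg hAB.symm hBD hBC hAD hAC hCD.symm hU' (by omega) hab
    rw [Finset.union_comm (K \ I), eK, add_comm (tau (K \ I) _ _ _ _),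
      add_comm (tau (Kᶜ \ I) _ _ _ _)] at h
    exact h

theorem sign_mem {ι : F} {f : Grass F} (hf : f ∈ E16Space ι) : sign f ∈ E16Space ι := by
  intro I hI
  have h1 : ∀ K, sign f K = ((-1 : F) ^ K.card) • f K := by
    intro K
    simp only [sign, LinearMap.pi_apply, LinearMap.smul_apply, LinearMap.proj_apply]
    rw [← Int.cast_smul_eq_zsmul F]
    simp
  have h2 : ∀ n (c : F) (a : F⟦X⟧), (PowerSeries.derivative F)^[n] (c • a) =
      c • (PowerSeries.derivative F)^[n] a := by
    intro n c
    induction n with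
    | zero => simp
    | succ n ih => intro a; simp [Function.iterate_succ_apply, ih]
  have h3 : (-1 : F) ^ Iᶜ.card = (-1) ^ I.card := by
    rw [Finset.card_compl, Fintype.card_fin]
    generalize I.card = n at hI
    interval_cases n <;> norm_num
  rw [h1, h1, h2, hf I hI, h3, smul_comm]

theorem derivative_mem_poly {a : F⟦X⟧}
    (ha : a ∈ (Polynomial.coeToPowerSeries.ringHom (R := F)).range) :
    PowerSeries.derivative F a ∈ (Polynomial.coeToPowerSeries.ringHom (R := F)).range := by
  obtain ⟨P, rfl⟩ := ha
  exact ⟨Polynomial.derivative P, (PowerSeries.derivative_coe P).symm⟩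

theorem bracket_mem_poly {f g : Grass F} (hf : f ∈ polyPart) (hg : g ∈ polyPart) :
    bracket f g ∈ (polyPart : Submodule F (Grass F)) := by
  intro K
  rw [bracket_apply]
  refine sum_mem fun I _ => ?_
  unfold tau
  split_ifs
  · exact zsmul_mem (sub_mem (zsmul_mem (mul_mem (hf _) (derivative_mem_poly (hg _))) _)
      (zsmul_mem (mul_mem (derivative_mem_poly (hf _)) (hg _)) _)) _
  · exact zsmul_mem (mul_mem (hf _) (hg _)) _
  · exact zero_mem _

theorem sign_mem_poly {f : Grass F} (hf : f ∈ polyPart) :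
    sign f ∈ (polyPart : Submodule F (Grass F)) :=
  fun K => zsmul_mem (hf K) _

end Grass

/-- A subsuperalgebra of the contact Lie superalgebra `K(1,6)` (the space `Grass F` with the
contact bracket): a subspace that is `ℤ/2`-graded, i.e. stable under the parity involution, and
closed under the bracket. -/
structure ContactSub (F : Type*) [Field F] extends Submodule F (Grass F) where
  sign_mem' : ∀ f ∈ carrier, Grass.sign f ∈ carrier
  bracket_mem' : ∀ f ∈ carrier, ∀ g ∈ carrier, Grass.bracket f g ∈ carrier

namespace ContactSub

variable {F : Type*} [Field F]

/-- The bracket of a subsuperalgebra. -/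
noncomputable def lie (L : ContactSub F) :
    L.toSubmodule →ₗ[F] L.toSubmodule →ₗ[F] L.toSubmodule :=
  LinearMap.mk₂ F
    (fun f g => ⟨Grass.bracket f.1 g.1, L.bracket_mem' _ f.2 _ g.2⟩)
    (fun _ _ _ => Subtype.ext (by simp))
    (fun _ _ _ => Subtype.ext (by simp))
    (fun _ _ _ => Subtype.ext (by simp))
    (fun _ _ _ => Subtype.ext (by simp))

/-- The `ℤ/2`-grading of a subsuperalgebra. -/
def parity (L : ContactSub F) (a : ZMod 2) : Submodule F L.toSubmodule :=
  (Grass.parityPart a).comap L.toSubmodule.subtype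

/-- The component of degree `j` in the gradation induced by the principal one. -/
def component (L : ContactSub F) (j : ℤ) : Submodule F L.toSubmodule :=
  (Grass.degPart j).comap L.toSubmodule.subtype

end ContactSub

/-- The exceptional Lie superalgebra `E(1,6)` in its linearly compact form (power series in `x`). -/
def E16 {F : Type*} [Field F] [CharZero F] (ι : F) (hι : ι ^ 2 = -1) : ContactSub F where
  toSubmodule := Grass.E16Space ι
  sign_mem' := fun _ hf => Grass.sign_mem hf
  bracket_mem' := fun _ hf _ hg => Grass.bracket_mem hι hf hg

/-- The exceptional Lie superalgebra `E(1,6)` in its `ℤ`-graded form (polynomials in `x`): the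
direct sum of the homogeneous components. -/
def E16Poly {F : Type*} [Field F] [CharZero F] (ι : F) (hι : ι ^ 2 = -1) : ContactSub F where
  toSubmodule := Grass.E16Space ι ⊓ Grass.polyPart
  sign_mem' := fun _ hf => ⟨Grass.sign_mem hf.1, Grass.sign_mem_poly hf.2⟩
  bracket_mem' := fun _ hf _ hg => ⟨Grass.bracket_mem hι hf.1 hg.1, Grass.bracket_mem_poly hf.2 hg.2⟩

/-- `(V, [·,·], σ)` is a Hom-Lie superalgebra, where `V` is graded by `𝒱 0` (even part) and `𝒱 1`
(odd part). -/
structure IsHomLieSuperalgebra {F V : Type*} [Field F] [AddCommGroup V] [Module F V]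
    (𝒱 : ZMod 2 → Submodule F V) (br : V →ₗ[F] V →ₗ[F] V) (σ : V →ₗ[F] V) : Prop where
  graded : DirectSum.IsInternal 𝒱
  bracket_even : ∀ a b : ZMod 2, ∀ x ∈ 𝒱 a, ∀ y ∈ 𝒱 b, br x y ∈ 𝒱 (a + b)
  map_even : ∀ a : ZMod 2, ∀ x ∈ 𝒱 a, σ x ∈ 𝒱 a
  map_bracket : ∀ a b : ZMod 2, ∀ x ∈ 𝒱 a, ∀ y ∈ 𝒱 b, σ (br x y) = br (σ x) (σ y)
  skew : ∀ a b : ZMod 2, ∀ x ∈ 𝒱 a, ∀ y ∈ 𝒱 b,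
    br x y = -((-1 : F) ^ (a.val * b.val) • br y x)
  hom_jacobi : ∀ a b c : ZMod 2, ∀ x ∈ 𝒱 a, ∀ y ∈ 𝒱 b, ∀ z ∈ 𝒱 c,
    (-1 : F) ^ (a.val * c.val) • br (σ x) (br y z) +
      (-1 : F) ^ (b.val * a.val) • br (σ y) (br z x) +
      (-1 : F) ^ (c.val * b.val) • br (σ z) (br x y) = 0

/-! In fact `σ` is the identity on the whole algebra; the two graded pieces only need their bases
identified. The argument uses just `1`, `x` and the `ξᵢ`. Hom-Jacobi on these elements makes `σ 1`
commute with `1` and with every `ξᵢ`, so `σ 1 = c` is a scalar (`map_one_eq`).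

Multiplicativity gives `σ [1, z] = c [1, σ z]`, and Hom-Jacobi for `x, 1, z` also contains `[1, σ
z]`. Eliminating it, and using that `[1, ·] = 2∂ₓ` is onto, yields `2 σ y = c² ([x, y] + 2y) - c [σ
x, y]` for all `y` (`map_eq`). If `c = 0`, then `σ = 0`.

Otherwise the formula at `y = 1` and `y = x` forces `c² = 1` and `σ x = x + b` with `(1 + c) b = 0`
(`map_X_eq`). This is the one place where the relations defining `E(1,6)` inside `K(1,6)` restrict
`σ`: they remove a possible `Λ⁴` part of `σ x`. For `c = 1` the formula becomes `σ y = y`. For `c =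
-1` it gives `σ ξᵢ = 0`, so `σ` kills `[ξᵢ, ξᵢ] = -1`, and then `σ = 0` (`map_eq_self`). -/

namespace Grass

variable {F : Type*} [Field F]

/-! ### Contact brackets with functions of `x` and with the `ξᵢ` -/

theorem mul_mono_empty_left (a : F⟦X⟧) (g : Grass F) (K : Finset (Fin 6)) :
    mul (mono ∅ a) g K = a * g K := by
  rw [mul_apply, Finset.sum_eq_single ∅]
  · simp [mono, sgn]
  · intro I _ hI
    simp [mono, Pi.single_eq_of_ne hI]
  · simp

theorem mul_mono_empty_right (a : F⟦X⟧) (g : Grass F) (K : Finset (Fin 6)) :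
    mul g (mono ∅ a) K = a * g K := by
  rw [mul_apply, Finset.sum_eq_single K]
  · simp [mono, sgn, mul_comm]
  · intro I hI hIK
    have : K \ I ≠ ∅ := fun h =>
      hIK (Finset.Subset.antisymm (Finset.mem_powerset.mp hI) (Finset.sdiff_eq_empty_iff_subset.mp h))
    simp [mono, Pi.single_eq_of_ne this]
  · simp

theorem dxi_mono_empty (i : Fin 6) (a : F⟦X⟧) : dxi i (mono ∅ a) = 0 := by
  funext K
  simp [dxi_apply, mono]

theorem sign_apply (f : Grass F) (K : Finset (Fin 6)) :
    sign f K = ((-1 : ℤ) ^ K.card) • f K := rfl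

theorem sign_mono_empty (a : F⟦X⟧) : sign (mono ∅ a) = mono ∅ a := by
  funext K
  rcases eq_or_ne K ∅ with rfl | hK
  · simp [sign_apply, mono]
  · simp [sign_apply, mono, Pi.single_eq_of_ne hK]

theorem dx_mono (I : Finset (Fin 6)) (a : F⟦X⟧) :
    dx (mono I a) = mono I (PowerSeries.derivative F a) := by
  funext K
  rcases eq_or_ne K I with rfl | hK
  · simp [dx_apply, mono]
  · simp [dx_apply, mono, Pi.single_eq_of_ne hK]

theorem euler_mono_empty (a : F⟦X⟧) : euler (mono ∅ a) = 0 := by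
  funext K
  rcases eq_or_ne K ∅ with rfl | hK
  · simp [euler_apply]
  · simp [euler_apply, mono, Pi.single_eq_of_ne hK]

/-- A function of `x` is killed by every `∂ᵢ` and by the Euler operator, which acts on the
`ξ_K`-component of `g` as `|K|`; the bracket is therefore diagonal in `K`. -/
theorem bracket_mono_empty_left (a : F⟦X⟧) (g : Grass F) (K : Finset (Fin 6)) :
    bracket (mono ∅ a) g K = 2 * a * PowerSeries.derivative F (g K) -
      PowerSeries.derivative F a * ((2 - (K.card : F⟦X⟧)) * g K) := by
  have h3 : ∀ a : F⟦X⟧, (2 : F) • a = 2 * a := fun a => by rw [two_smul, two_mul]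
  simp only [bracket, LinearMap.add_apply, LinearMap.sub_apply, LinearMap.sum_apply,
    LinearMap.compl₁₂_apply, LinearMap.comp_apply, sign_mono_empty, dxi_mono_empty, map_zero,
    LinearMap.zero_apply, Finset.sum_const_zero, add_zero, LinearMap.smul_apply,
    LinearMap.id_apply, euler_mono_empty, sub_zero, map_smul, dx_mono, Pi.sub_apply, Pi.smul_apply,
    mul_mono_empty_left, dx_apply, euler_apply, h3, nsmul_eq_mul]
  ring

theorem bracket_mono_empty_right (a : F⟦X⟧) (g : Grass F) :
    bracket g (mono ∅ a) = -bracket (mono ∅ a) g := by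
  funext K
  have h3 : ∀ a : F⟦X⟧, (2 : F) • a = 2 * a := fun a => by rw [two_smul, two_mul]
  rw [Pi.neg_apply, bracket_mono_empty_left]
  simp only [bracket, LinearMap.add_apply, LinearMap.sub_apply, LinearMap.sum_apply,
    LinearMap.compl₁₂_apply, LinearMap.comp_apply, dxi_mono_empty, map_zero,
    Finset.sum_const_zero, add_zero, LinearMap.smul_apply,
    LinearMap.id_apply, euler_mono_empty, sub_zero, map_smul, dx_mono, Pi.sub_apply, Pi.smul_apply,
    mul_mono_empty_right, dx_apply, euler_apply, h3, nsmul_eq_mul]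
  ring

theorem bracket_one_left (g : Grass F) : bracket (mono ∅ 1) g = (2 : F) • dx g := by
  funext K
  rw [bracket_mono_empty_left, Pi.smul_apply, two_smul, dx_apply]
  simp [two_mul]

theorem bracket_one_right (g : Grass F) : bracket g (mono ∅ 1) = -((2 : F) • dx g) := by
  rw [bracket_mono_empty_right, bracket_one_left]

theorem bracket_X_left_apply (g : Grass F) (K : Finset (Fin 6)) :
    bracket (mono ∅ PowerSeries.X) g K =
      2 * PowerSeries.X * PowerSeries.derivative F (g K) - (2 - (K.card : F⟦X⟧)) * g K := by
  rw [bracket_mono_empty_left, PowerSeries.derivative_X, one_mul]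

/-- This is the Jacobi identity of `K(1,6)` for `1, x, g`, with `[1, x] = 2`. It is checked by hand,
so Jacobi is not needed in general. -/
theorem dx_bracket_X (g : Grass F) :
    (2 : F) • dx (bracket (mono ∅ PowerSeries.X) g) =
      bracket (mono ∅ PowerSeries.X) ((2 : F) • dx g) +
        (2 : F) • ((2 : F) • dx g) := by
  funext K
  have h3 : ∀ a : F⟦X⟧, (2 : F) • a = 2 * a := fun a => by rw [two_smul, two_mul]
  have h4 : PowerSeries.derivative F (2 : F⟦X⟧) = 0 := by
    simpa using (PowerSeries.derivative F).map_natCast 2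
  simp only [Pi.add_apply, Pi.smul_apply, map_smul, dx_apply, bracket_X_left_apply,
    map_sub, Derivation.leibniz, smul_eq_mul, h3, h4, PowerSeries.derivative_X,
    Derivation.map_natCast]
  ring

theorem dxi_xi (i j : Fin 6) : dxi j (xi i : Grass F) = if j = i then mono ∅ 1 else 0 := by
  funext K
  rw [dxi_apply]
  by_cases hK : K = ∅
  · subst hK
    by_cases h : j = i
    · subst h; simp [xi, mono, sgn]
    · simp [h, xi, mono]
  · have h0 : (if j = i then mono ∅ 1 else 0 : Grass F) K = 0 := by
      split_ifs <;> simp [mono, Pi.single_eq_of_ne hK]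
    rw [h0]
    split_ifs with hj
    · rfl
    · have : insert j K ≠ {i} := by
        intro h
        have h1 := congrArg Finset.card h
        rw [Finset.card_insert_of_notMem hj, Finset.card_singleton] at h1
        exact hK (Finset.card_eq_zero.mp (by omega))
      simp [xi, mono, Pi.single_eq_of_ne this]

theorem dx_xi (i : Fin 6) : dx (xi i : Grass F) = 0 := by
  rw [xi, dx_mono]
  simp [mono]

theorem bracket_xi_right {f : Grass F} (hf : dx f = 0) (i : Fin 6) :
    bracket f (xi i) = dxi i (sign f) := by
  funext K
  simp only [bracket, LinearMap.add_apply, LinearMap.sub_apply, LinearMap.sum_apply,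
    LinearMap.compl₁₂_apply, LinearMap.comp_apply, dx_xi, hf, map_zero, LinearMap.zero_apply,
    sub_zero, zero_add, dxi_xi]
  rw [Finset.sum_eq_single i]
  · simp [mul_mono_empty_right]
  · intro j _ hj
    simp [hj]
  · simp

theorem sign_xi (i : Fin 6) : sign (xi i : Grass F) = -xi i := by
  funext K
  rw [sign_apply]
  rcases eq_or_ne K {i} with rfl | hK
  · simp
  · simp [xi, mono, Pi.single_eq_of_ne hK]

theorem bracket_xi_self (i : Fin 6) : bracket (xi i) (xi i : Grass F) = -mono ∅ 1 := by
  rw [bracket_xi_right (dx_xi i), sign_xi, map_neg, dxi_xi, if_pos rfl]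

theorem bracket_X_xi (i : Fin 6) :
    bracket (mono ∅ PowerSeries.X) (xi i : Grass F) = -xi i := by
  funext K
  rw [bracket_X_left_apply, ← dx_apply, dx_xi]
  rcases eq_or_ne K {i} with rfl | hK
  · simp only [Pi.zero_apply, mul_zero, Finset.card_singleton, Pi.neg_apply]
    push_cast
    ring
  · simp [xi, mono, Pi.single_eq_of_ne hK]

theorem eq_C_of_derivative_eq_zero [CharZero F] {a : F⟦X⟧} (h : PowerSeries.derivative F a = 0) :
    a = PowerSeries.C (PowerSeries.constantCoeff a) := by
  ext n
  rcases n with _ | n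
  · simp
  · have h1 := congrArg (PowerSeries.coeff n) h
    rw [PowerSeries.coeff_derivative, map_zero] at h1
    have h2 : (n : F) + 1 ≠ 0 := Nat.cast_add_one_ne_zero n
    rw [(mul_eq_zero.mp h1).resolve_right h2, PowerSeries.coeff_C, if_neg n.succ_ne_zero]

/-- An element killed by all the derivations `∂ₓ`, `∂ᵢ` is a scalar. -/
theorem eq_smul_one_of_bracket_eq_zero [CharZero F] {f : Grass F} (hf : dx f = 0)
    (h : ∀ i, bracket f (xi i) = 0) : ∃ c : F, f = c • mono ∅ 1 := by
  refine ⟨PowerSeries.constantCoeff (f ∅), ?_⟩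
  funext K
  rcases K.eq_empty_or_nonempty with rfl | ⟨i, hi⟩
  · have h0 : PowerSeries.derivative F (f ∅) = 0 := congrFun hf ∅
    conv_lhs => rw [eq_C_of_derivative_eq_zero h0]
    simp [mono, PowerSeries.smul_eq_C_mul]
  -- For `i ∈ K`, the component of `∂ᵢ f` at `K` without `i` is `± f K`.
  · have h1 := congrFun (h i) (K.erase i)
    rw [bracket_xi_right hf, dxi_apply, if_neg (Finset.notMem_erase i K),
      Finset.insert_erase hi, sign_apply, smul_smul, Pi.zero_apply, sgn, ← pow_add] at h1
    have h2 : f K = 0 := by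
      rcases neg_one_pow_eq_or ℤ (((({i} : Finset (Fin 6)) ×ˢ K.erase i).filter
        fun p => p.2 < p.1).card + K.card) with h3 | h3 <;> rw [h3] at h1 <;> simpa using h1
    rw [h2]
    simp [mono, Pi.single_eq_of_ne (Finset.ne_empty_of_mem hi)]

/-! ### Surjectivity of `∂ₓ` and membership of monomials -/

/-- The antiderivative with zero constant term. -/
noncomputable def antideriv (a : F⟦X⟧) : F⟦X⟧ :=
  -- At `n = 0` the truncated index `n - 1` is meaningless, and the zero factor discards it.
  PowerSeries.mk fun n => PowerSeries.coeff (n - 1) a * (if n = 0 then 0 else (n : F)⁻¹)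

theorem derivative_antideriv [CharZero F] (a : F⟦X⟧) :
    PowerSeries.derivative F (antideriv a) = a := by
  ext n
  have h2 : (n : F) + 1 ≠ 0 := Nat.cast_add_one_ne_zero n
  simp [antideriv, PowerSeries.coeff_derivative, PowerSeries.coeff_mk, h2]

theorem antideriv_smul (c : F) (a : F⟦X⟧) : antideriv (c • a) = c • antideriv a := by
  ext n
  simp [antideriv, mul_assoc]

theorem antideriv_mem_poly {a : F⟦X⟧}
    (ha : a ∈ (Polynomial.coeToPowerSeries.ringHom (R := F)).range) :
    antideriv a ∈ (Polynomial.coeToPowerSeries.ringHom (R := F)).range := by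
  obtain ⟨P, rfl⟩ := ha
  -- Integration raises the degree by at most one, and `trunc` keeps only exponents strictly below
  -- its bound.
  refine ⟨PowerSeries.trunc (P.natDegree + 2) (antideriv (P : F⟦X⟧)), ?_⟩
  ext n
  simp only [Polynomial.coeToPowerSeries.ringHom_apply, Polynomial.coeff_coe,
    PowerSeries.coeff_trunc]
  split_ifs with h
  · rfl
  · simp [antideriv, Polynomial.coeff_eq_zero_of_natDegree_lt (show P.natDegree < n - 1 by omega)]

theorem iterate_derivative_mem_poly {a : F⟦X⟧}
    (ha : a ∈ (Polynomial.coeToPowerSeries.ringHom (R := F)).range) (n : ℕ) :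
    (PowerSeries.derivative F)^[n] a ∈ (Polynomial.coeToPowerSeries.ringHom (R := F)).range := by
  induction n with
  | zero => exact ha
  | succ n ih => rw [Function.iterate_succ_apply']; exact derivative_mem_poly ih

theorem smul_mem_poly (c : F) {a : F⟦X⟧}
    (ha : a ∈ (Polynomial.coeToPowerSeries.ringHom (R := F)).range) :
    c • a ∈ (Polynomial.coeToPowerSeries.ringHom (R := F)).range := by
  rw [PowerSeries.smul_eq_C_mul]
  exact mul_mem ⟨Polynomial.C c, by simp⟩ ha

/-- Components with `|I| ≤ 3` can be integrated freely; the higher ones are then forced by the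
defining relations. Both operations preserve polynomials. -/
theorem exists_dx_eq [CharZero F] {ι : F} {f : Grass F} (hf : f ∈ E16Space ι) :
    ∃ g ∈ E16Space ι, dx g = f ∧ (f ∈ (polyPart : Submodule F (Grass F)) → g ∈ polyPart) := by
  have hc : ∀ I : Finset (Fin 6), Iᶜ.card = 6 - I.card := fun I => by
    rw [Finset.card_compl, Fintype.card_fin]
  -- In the second branch, one of the `3 - |Iᶜ|` derivatives cancels against the antiderivative,
  -- which leaves `2 - |Iᶜ|`.
  refine ⟨fun I => if I.card ≤ 3 then antideriv (f I) else
    coef ι Iᶜ • (PowerSeries.derivative F)^[2 - Iᶜ.card] (f Iᶜ), ?_, ?_, ?_⟩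
  · intro I hI
    simp only [hI, if_true]
    by_cases h : I.card = 3
    · rw [if_pos (by rw [hc]; omega), hf I hI, h]
      simp [antideriv_smul]
    · rw [if_neg (by rw [hc]; omega), compl_compl, show 3 - I.card = (2 - I.card) + 1 by omega,
        Function.iterate_succ_apply, derivative_antideriv]
  · funext I
    rw [dx_apply]
    split_ifs with h
    · exact derivative_antideriv _
    · have h1 := hf Iᶜ (by rw [hc]; omega)
      rw [compl_compl, show 3 - Iᶜ.card = (2 - Iᶜ.card) + 1 by rw [hc]; omega,
        Function.iterate_succ_apply'] at h1
      rw [h1, Derivation.map_smul]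
  · intro hp I
    dsimp only
    split_ifs
    · exact antideriv_mem_poly (hp I)
    · exact smul_mem_poly _ (iterate_derivative_mem_poly (hp _) _)

/-- The hypothesis says that the dual correction term vanishes, so the monomial is itself one of the
spanning elements. -/
theorem mono_mem_E16Space {ι : F} {I : Finset (Fin 6)} (hI : I.card < 3) {a : F⟦X⟧}
    (ha : (PowerSeries.derivative F)^[3 - I.card] a = 0) : mono I a ∈ E16Space ι := by
  intro J hJ
  have hc : Jᶜ.card = 6 - J.card := by rw [Finset.card_compl, Fintype.card_fin]
  have h1 : Jᶜ ≠ I := by rintro rfl; omega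
  rcases eq_or_ne J I with rfl | h
  · simp [mono, ha]
  · simp [mono, Pi.single_eq_of_ne h1, Pi.single_eq_of_ne h, iterate_map_zero]

theorem mono_mem_polyPart {I : Finset (Fin 6)} {a : F⟦X⟧}
    (ha : a ∈ (Polynomial.coeToPowerSeries.ringHom (R := F)).range) :
    mono I a ∈ (polyPart : Submodule F (Grass F)) := by
  intro J
  rcases eq_or_ne J I with rfl | h
  · simpa [mono] using ha
  · simp only [mono, Pi.single_eq_of_ne h]
    exact zero_mem _

theorem mono_mem_parityPart (I : Finset (Fin 6)) (a : F⟦X⟧) :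
    mono I a ∈ (parityPart (I.card : ZMod 2) : Submodule F (Grass F)) := by
  intro J hJ
  have : J ≠ I := by rintro rfl; exact hJ rfl
  simp [mono, Pi.single_eq_of_ne this]

end Grass

/-! ### Hom-Lie structures on a subsuperalgebra of `K(1,6)` -/

namespace ContactSub

variable {F : Type*} [Field F]

theorem lie_coe (L : ContactSub F) (f g : L.toSubmodule) :
    (L.lie f g : Grass F) = Grass.bracket f.1 g.1 := rfl

theorem mono_empty_mem_parity (L : ContactSub F) {a : F⟦X⟧}
    (h : Grass.mono ∅ a ∈ L.toSubmodule) : (⟨Grass.mono ∅ a, h⟩ : L.toSubmodule) ∈ L.parity 0 := by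
  have h0 := Grass.mono_mem_parityPart ∅ a
  rwa [Finset.card_empty, Nat.cast_zero] at h0

theorem xi_mem_parity (L : ContactSub F) {i : Fin 6} (h : Grass.xi i ∈ L.toSubmodule) :
    (⟨Grass.xi i, h⟩ : L.toSubmodule) ∈ L.parity 1 := by
  have h1 := Grass.mono_mem_parityPart {i} (1 : F⟦X⟧)
  rwa [Finset.card_singleton, Nat.cast_one] at h1

variable {L : ContactSub F} {σ : L.toSubmodule →ₗ[F] L.toSubmodule}

/-- The Hom-Lie axioms speak of homogeneous elements only; additive consequences extend to all
elements because the parity components span. -/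
theorem induction_parity (hσ : IsHomLieSuperalgebra L.parity L.lie σ) {p : L.toSubmodule → Prop}
    (h : ∀ a, ∀ z ∈ L.parity a, p z) (h0 : p 0) (hadd : ∀ x y, p x → p y → p (x + y))
    (z : L.toSubmodule) : p z :=
  Submodule.iSup_induction _ (motive := p)
    (hσ.graded.submodule_iSup_eq_top ▸ Submodule.mem_top : z ∈ ⨆ a, L.parity a) h h0 hadd

theorem map_lie_one (hσ : IsHomLieSuperalgebra L.parity L.lie σ)
    (h1 : Grass.mono ∅ 1 ∈ L.toSubmodule)
    {c : F} (hc : (σ ⟨Grass.mono ∅ 1, h1⟩ : Grass F) = c • Grass.mono ∅ 1)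
    (z : L.toSubmodule) :
    (σ (L.lie ⟨Grass.mono ∅ 1, h1⟩ z) : Grass F) = (2 * c) • Grass.dx (σ z : Grass F) := by
  revert z
  refine induction_parity hσ ?_ ?_ ?_
  · intro a z hz
    rw [hσ.map_bracket 0 a _ (L.mono_empty_mem_parity h1) z hz, lie_coe, hc, map_smul,
      LinearMap.smul_apply, Grass.bracket_one_left, smul_smul, mul_comm]
  · simp
  · intro x y hx hy
    simp only [map_add, Submodule.coe_add, smul_add, hx, hy]

/-- The Hom-Jacobi identity for `x`, `1`, `z`, where `σ 1 = c`. -/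
theorem jacobi_X_one (hσ : IsHomLieSuperalgebra L.parity L.lie σ)
    (h1 : Grass.mono ∅ 1 ∈ L.toSubmodule) (hX : Grass.mono ∅ PowerSeries.X ∈ L.toSubmodule)
    {c : F} (hc : (σ ⟨Grass.mono ∅ 1, h1⟩ : Grass F) = c • Grass.mono ∅ 1)
    (z : L.toSubmodule) :
    Grass.bracket (σ ⟨Grass.mono ∅ PowerSeries.X, hX⟩ : Grass F) ((2 : F) • Grass.dx z.1) -
      (2 * c) • Grass.dx (Grass.bracket (Grass.mono ∅ PowerSeries.X) z.1) +
      (4 : F) • Grass.dx (σ z : Grass F) = 0 := by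
  revert z
  refine induction_parity hσ ?_ ?_ ?_
  · intro a z hz
    have h := congrArg Subtype.val (hσ.hom_jacobi 0 0 a _ (L.mono_empty_mem_parity hX) _
      (L.mono_empty_mem_parity h1) z hz)
    simp only [Submodule.coe_add, lie_coe, hc, map_smul, LinearMap.smul_apply,
      Grass.bracket_one_right, Grass.bracket_one_left,
      Grass.bracket_mono_empty_right PowerSeries.X, map_neg, Grass.dx_mono,
      PowerSeries.derivative_X, smul_neg, neg_neg,
      ZMod.val_zero, zero_mul, mul_zero, pow_zero, one_smul, Submodule.coe_zero] at h
    rw [← h, map_smul]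
    module
  · simp
  · intro x y hx hy
    have := congrArg₂ (· + ·) hx hy
    simp only [add_zero] at this
    rw [← this]
    simp only [map_add, Submodule.coe_add, smul_add]
    abel

/-- A Hom-Lie structure on a subsuperalgebra of `K(1,6)` is determined by its values at `1`
and `x`, if `[1, ·]` is onto. -/
theorem map_eq (hσ : IsHomLieSuperalgebra L.parity L.lie σ)
    (h1 : Grass.mono ∅ 1 ∈ L.toSubmodule) (hX : Grass.mono ∅ PowerSeries.X ∈ L.toSubmodule)
    (hsurj : ∀ y, ∃ z, L.lie ⟨Grass.mono ∅ 1, h1⟩ z = y)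
    {c : F} (hc : (σ ⟨Grass.mono ∅ 1, h1⟩ : Grass F) = c • Grass.mono ∅ 1)
    (y : L.toSubmodule) :
    (2 : F) • (σ y : Grass F) = (c * c) • (Grass.bracket (Grass.mono ∅ PowerSeries.X) y.1 +
      (2 : F) • y.1) - c • Grass.bracket (σ ⟨Grass.mono ∅ PowerSeries.X, hX⟩ : Grass F) y.1 := by
  obtain ⟨z, rfl⟩ := hsurj y
  -- With `y = [1, z]`, multiplying this identity by `c` turns its last term `4 ∂ₓ σ z` into `2 σ
  -- y`.
  have h := jacobi_X_one hσ h1 hX hc z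
  rw [mul_comm, mul_smul, Grass.dx_bracket_X] at h
  rw [map_lie_one hσ h1 hc, lie_coe, Grass.bracket_one_left]
  linear_combination (norm := module) c • h

/-- Every element is some `[1, z]`, and its image is `[σ 1, σ z]`. -/
theorem eq_zero_of_map_one (hσ : IsHomLieSuperalgebra L.parity L.lie σ)
    (h1 : Grass.mono ∅ 1 ∈ L.toSubmodule)
    (hsurj : ∀ y, ∃ z, L.lie ⟨Grass.mono ∅ 1, h1⟩ z = y)
    (hc : (σ ⟨Grass.mono ∅ 1, h1⟩ : Grass F) = 0) : σ = 0 := by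
  refine LinearMap.ext fun y => Subtype.ext ?_
  obtain ⟨z, rfl⟩ := hsurj y
  rw [map_lie_one hσ h1 (c := 0) (by rw [hc, zero_smul]), mul_zero, zero_smul]
  rfl

variable [CharZero F]

/-- Hom-Jacobi for `ξᵢ, ξᵢ, ξᵢ` consists of three equal terms, so `[σ ξᵢ, [ξᵢ, ξᵢ]] = 0`, where
`[ξᵢ, ξᵢ] = -1`. -/
theorem dx_map_xi (hσ : IsHomLieSuperalgebra L.parity L.lie σ) {i : Fin 6}
    (hξ : Grass.xi i ∈ L.toSubmodule) :
    Grass.dx (σ ⟨Grass.xi i, hξ⟩ : Grass F) = 0 := by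
  have hp := L.xi_mem_parity hξ
  have h := congrArg Subtype.val (hσ.hom_jacobi 1 1 1 _ hp _ hp _ hp)
  simp only [Submodule.coe_add, Submodule.coe_smul, lie_coe, Grass.bracket_xi_self, map_neg,
    Grass.bracket_one_right, ZMod.val_one, Submodule.coe_zero] at h
  rw [← add_smul, ← add_smul, neg_neg, smul_smul] at h
  refine (smul_eq_zero.mp h).resolve_left ?_
  norm_num

/-- Hom-Jacobi for `1, ξ₀, ξ₀` (with `ξ₀` the indeterminate of index `0`) gives `[σ 1, 1] = 0`. For
`x, 1, ξᵢ` it gives `[σ 1, ξᵢ] = 0`, since `[1, ξᵢ] = 0` and `[σ ξᵢ, [x, 1]]` is a multiple of `∂ₓ σ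
ξᵢ = 0`. Only scalars satisfy both. -/
theorem map_one_eq (hσ : IsHomLieSuperalgebra L.parity L.lie σ)
    (h1 : Grass.mono ∅ 1 ∈ L.toSubmodule) (hX : Grass.mono ∅ PowerSeries.X ∈ L.toSubmodule)
    (hξ : ∀ i, Grass.xi i ∈ L.toSubmodule) :
    ∃ c : F, (σ ⟨Grass.mono ∅ 1, h1⟩ : Grass F) = c • Grass.mono ∅ 1 := by
  apply Grass.eq_smul_one_of_bracket_eq_zero
  · have hp := L.xi_mem_parity (hξ 0)
    have h := congrArg Subtype.val (hσ.hom_jacobi 0 1 1 _ (L.mono_empty_mem_parity h1) _ hp _ hp)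
    simp only [Submodule.coe_add, Submodule.coe_smul, lie_coe, Grass.bracket_xi_self, map_neg,
      Grass.bracket_one_right, Grass.bracket_one_left, Grass.dx_xi, smul_zero, neg_zero, map_zero,
      add_zero, neg_neg, ZMod.val_zero, zero_mul, pow_zero, one_smul, Submodule.coe_zero] at h
    exact (smul_eq_zero.mp h).resolve_left two_ne_zero
  · intro i
    have hp := L.xi_mem_parity (hξ i)
    have h := congrArg Subtype.val (hσ.hom_jacobi 0 0 1 _ (L.mono_empty_mem_parity hX) _
      (L.mono_empty_mem_parity h1) _ hp)
    simpa [lie_coe, Grass.bracket_one_right, Grass.bracket_one_left, Grass.dx_xi,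
      Grass.bracket_mono_empty_right PowerSeries.X, Grass.bracket_X_xi, Grass.dx_mono,
      dx_map_xi hσ (hξ i)] using h

/-- If `σ 1 = c ≠ 0`, then `c = ±1` and `σ x = x + b` for a scalar `b` with `b = -c b`. -/
theorem map_X_eq {ι : F} (hE : L.toSubmodule ≤ Grass.E16Space ι)
    (hσ : IsHomLieSuperalgebra L.parity L.lie σ)
    (h1 : Grass.mono ∅ 1 ∈ L.toSubmodule) (hX : Grass.mono ∅ PowerSeries.X ∈ L.toSubmodule)
    (hsurj : ∀ y, ∃ z, L.lie ⟨Grass.mono ∅ 1, h1⟩ z = y)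
    {c : F} (hc : (σ ⟨Grass.mono ∅ 1, h1⟩ : Grass F) = c • Grass.mono ∅ 1) (hc0 : c ≠ 0) :
    c * c = 1 ∧ ∃ b : F, b = -c * b ∧
      (σ ⟨Grass.mono ∅ PowerSeries.X, hX⟩ : Grass F) =
        Grass.mono ∅ PowerSeries.X + b • Grass.mono ∅ 1 := by
  obtain ⟨s, hs⟩ : ∃ s, s = σ ⟨Grass.mono ∅ PowerSeries.X, hX⟩ := ⟨_, rfl⟩
  have h2 : (2 : F) ≠ 0 := two_ne_zero
  have hd : Grass.dx s.1 = Grass.mono ∅ 1 := by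
    -- At `y = 1` the `c²` term drops out because `[x, 1] = -2`.
    have h := map_eq hσ h1 hX hsurj hc ⟨Grass.mono ∅ 1, h1⟩
    rw [hc, ← hs] at h
    simp only [Grass.bracket_one_right, Grass.dx_mono, PowerSeries.derivative_X] at h
    have h' : (2 * c) • (Grass.dx s.1 - Grass.mono ∅ 1) = 0 := by
      rw [← sub_eq_zero] at h
      rw [← neg_zero, ← h]
      module
    exact sub_eq_zero.mp ((smul_eq_zero.mp h').resolve_left (mul_ne_zero h2 hc0))
  obtain ⟨h, hh⟩ : ∃ h : Grass F, h = s.1 - Grass.mono ∅ PowerSeries.X := ⟨_, rfl⟩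
  have hsh : s.1 = Grass.mono ∅ PowerSeries.X + h := by rw [hh]; abel
  have hdh : Grass.dx h = 0 := by
    rw [hh, map_sub, hd, Grass.dx_mono, PowerSeries.derivative_X, sub_self]
  have hhE : h ∈ Grass.E16Space ι := hh ▸ sub_mem (hE s.2) (hE hX)
  have hXX : Grass.bracket (Grass.mono ∅ PowerSeries.X) (Grass.mono ∅ PowerSeries.X : Grass F) = 0 := by
    have := Grass.bracket_mono_empty_right PowerSeries.X (Grass.mono ∅ PowerSeries.X : Grass F)
    have h' : (2 : F) • Grass.bracket (Grass.mono ∅ PowerSeries.X)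
        (Grass.mono ∅ PowerSeries.X : Grass F) = 0 := by
      rw [two_smul]
      nth_rw 1 [this]
      exact neg_add_cancel _
    exact (smul_eq_zero.mp h').resolve_left h2
  have hm : (2 : F) • (Grass.mono ∅ PowerSeries.X + h) =
      (c * c * 2) • Grass.mono ∅ PowerSeries.X +
        c • Grass.bracket (Grass.mono ∅ PowerSeries.X) h := by
    have h' := map_eq hσ h1 hX hsurj hc ⟨Grass.mono ∅ PowerSeries.X, hX⟩
    rw [← hs, hsh, map_add, LinearMap.add_apply, hXX,
      Grass.bracket_mono_empty_right PowerSeries.X h] at h'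
    rw [h']
    module
  have hbr : ∀ K, Grass.bracket (Grass.mono ∅ PowerSeries.X) h K = ((K.card : F) - 2) • h K := by
    intro K
    rw [Grass.bracket_X_left_apply, ← Grass.dx_apply, hdh, PowerSeries.smul_eq_C_mul]
    simp only [Pi.zero_apply, mul_zero, zero_sub, map_sub, map_natCast, map_ofNat]
    ring
  -- The coefficient of `x` is compared on both sides of `hm`; `h` does not contribute, as its
  -- components are constants.
  have hcc : c * c = 1 := by
    have h' := congrArg (fun f : Grass F => PowerSeries.coeff 1 (f ∅)) hm
    have hC : PowerSeries.coeff 1 (h ∅) = 0 := by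
      rw [Grass.eq_C_of_derivative_eq_zero
        (show PowerSeries.derivative F (h ∅) = 0 from congrFun hdh ∅)]
      simp
    simp only [Pi.smul_apply, Pi.add_apply, hbr, PowerSeries.coeff_smul, map_add, hC,
      smul_eq_mul, mul_zero, add_zero] at h'
    simp only [Grass.mono, Pi.single_eq_same, PowerSeries.coeff_one_X, mul_one] at h'
    exact mul_right_cancel₀ h2 (by rw [← h', one_mul])
  rw [hcc, one_mul, smul_add, add_right_inj] at hm
  have hK : ∀ K : Finset (Fin 6), (2 - c * ((K.card : F) - 2)) • h K = 0 := by
    intro K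
    have := congrFun hm K
    rw [Pi.smul_apply, Pi.smul_apply, hbr, ← sub_eq_zero] at this
    rw [← this]
    module
  have hzero : ∀ K : Finset (Fin 6), K ≠ ∅ → h K = 0 := by
    intro K hne
    -- `2 = c (|K| - 2)` with `c = ±1` allows `|K| = 0` or `4`. For `|K| = 4` the defining relation
    -- makes `h K` a multiple of the derivative of `h Kᶜ`, which is zero.
    by_cases h4 : K.card = 4
    · have := hhE Kᶜ (by rw [Finset.card_compl, Fintype.card_fin]; omega)
      rw [compl_compl, Finset.card_compl, Fintype.card_fin, h4] at this
      rw [this, Function.iterate_one, ← Grass.dx_apply, hdh]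
      simp
    · refine (smul_eq_zero.mp (hK K)).resolve_left fun h0 => ?_
      have hsq : ((K.card : F) - 2) ^ 2 = 4 := by
        linear_combination ((K.card : F) - 2) ^ 2 * (-hcc) - (2 + c * ((K.card : F) - 2)) * h0
      have hle : K.card ≤ 6 := by simpa using Finset.card_le_univ K
      have hpos : K.card ≠ 0 := fun h => hne (Finset.card_eq_zero.mp h)
      have hz : (((K.card : ℤ) - 2) ^ 2 - 4 : ℤ) = 0 := by
        have : ((((K.card : ℤ) - 2) ^ 2 - 4 : ℤ) : F) = 0 := by push_cast; rw [hsq, sub_self]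
        exact_mod_cast this
      have : ((K.card : ℤ) - 4) * (K.card : ℤ) = 0 := by linear_combination hz
      rcases mul_eq_zero.mp this with h | h <;> omega
  have hconst : h ∅ = PowerSeries.C (PowerSeries.constantCoeff (h ∅)) :=
    Grass.eq_C_of_derivative_eq_zero (show PowerSeries.derivative F (h ∅) = 0 from congrFun hdh ∅)
  refine ⟨hcc, PowerSeries.constantCoeff (h ∅), ?_, ?_⟩
  · have := congrArg PowerSeries.constantCoeff (hK ∅)
    rw [PowerSeries.smul_eq_C_mul, map_mul] at this
    simp at this
    have h3 : (2 : F) * ((1 + c) * PowerSeries.constantCoeff (h ∅)) = 0 := by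
      rcases this with h' | h'
      · linear_combination PowerSeries.constantCoeff (h ∅) * h'
      · rw [h']; ring
    linear_combination (mul_eq_zero.mp h3).resolve_left h2
  · rw [← hs, hsh]
    congr 1
    funext K
    rcases eq_or_ne K ∅ with rfl | hne
    · conv_lhs => rw [hconst]
      simp [Grass.mono, PowerSeries.smul_eq_C_mul]
    · rw [hzero K hne]
      simp [Grass.mono, Pi.single_eq_of_ne hne]

/-- The sign of `c` decides. For `c = 1` also `b = 0`, and the two brackets with `x` in `map_eq`
cancel. For `c = -1` they add up to `2 [x, y]`, which at `y = ξ₀` cancels `2y` since `[x, ξ₀] =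
-ξ₀`; then `σ ξ₀ = 0` forces `σ 1 = 0`. -/
theorem map_eq_self {ι : F} (hE : L.toSubmodule ≤ Grass.E16Space ι)
    (hσ : IsHomLieSuperalgebra L.parity L.lie σ) (hσ0 : σ ≠ 0)
    (h1 : Grass.mono ∅ 1 ∈ L.toSubmodule) (hX : Grass.mono ∅ PowerSeries.X ∈ L.toSubmodule)
    (hξ : ∀ i, Grass.xi i ∈ L.toSubmodule)
    (hsurj : ∀ y, ∃ z, L.lie ⟨Grass.mono ∅ 1, h1⟩ z = y) (v : L.toSubmodule) : σ v = v := by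
  obtain ⟨c, hc⟩ := map_one_eq hσ h1 hX hξ
  have hc0 : c ≠ 0 := by
    rintro rfl
    exact hσ0 (eq_zero_of_map_one hσ h1 hsurj (by rw [hc, zero_smul]))
  obtain ⟨hcc, b, hb, hx⟩ := map_X_eq hE hσ h1 hX hsurj hc hc0
  have h2 : (2 : F) ≠ 0 := two_ne_zero
  have key := map_eq hσ h1 hX hsurj hc
  rw [hx] at key
  rcases mul_self_eq_one_iff.mp hcc with rfl | rfl
  · have hb0 : b = 0 := by
      have : (2 : F) * b = 0 := by linear_combination hb
      exact (mul_eq_zero.mp this).resolve_left h2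
    subst hb0
    refine Subtype.ext (smul_right_injective _ h2 ?_)
    have := key v
    rw [zero_smul, add_zero] at this
    simp only
    rw [this]
    module
  · exfalso
    have hp := L.xi_mem_parity (hξ 0)
    have hz : σ ⟨Grass.xi 0, hξ 0⟩ = 0 := by
      refine Subtype.ext (smul_right_injective _ h2 ?_)
      have := key ⟨Grass.xi 0, hξ 0⟩
      simp only [map_add, map_smul, LinearMap.add_apply, LinearMap.smul_apply,
        Grass.bracket_one_left, Grass.dx_xi, Grass.bracket_X_xi, smul_zero, add_zero] at this
      simp only [Submodule.coe_zero, smul_zero]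
      rw [this]
      module
    refine hσ0 (eq_zero_of_map_one hσ h1 hsurj ?_)
    have h := hσ.map_bracket 1 1 _ hp _ hp
    have he : L.lie ⟨Grass.xi 0, hξ 0⟩ ⟨Grass.xi 0, hξ 0⟩ = -⟨Grass.mono ∅ 1, h1⟩ :=
      Subtype.ext (Grass.bracket_xi_self 0)
    rw [hz, he, map_neg, map_zero, neg_eq_zero] at h
    rw [h]
    rfl

end ContactSub

/-! ### The components of degree `-1` and `0` -/

namespace Grass

variable {F : Type*} [Field F]

theorem sum_mono (f : Grass F) : ∑ I, mono I (f I) = f := Finset.univ_sum_single f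

theorem mono_smul (I : Finset (Fin 6)) (c : F) (a : F⟦X⟧) : mono I (c • a) = c • mono I a :=
  Pi.single_smul (f := fun _ : Finset (Fin 6) => F⟦X⟧) I c a

theorem mono_C (I : Finset (Fin 6)) (a : F) : mono I (PowerSeries.C a) = a • mono I 1 := by
  rw [← mono_smul, PowerSeries.smul_eq_C_mul, mul_one]

theorem mono_mem_degPart (I : Finset (Fin 6)) (n : ℕ) :
    mono I (PowerSeries.X ^ n) ∈ (degPart (2 * n + I.card - 2) : Submodule F (Grass F)) := by
  intro J m h
  rcases eq_or_ne J I with rfl | hJ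
  · have : m ≠ n := by rintro rfl; exact h rfl
    simp [mono, PowerSeries.coeff_X_pow, this]
  · simp [mono, Pi.single_eq_of_ne hJ]

theorem mul_xi_xi {i j : Fin 6} (hij : i ≠ j) :
    mul (xi i) (xi j) = (sgn {i} {j} : F) • (mono {i, j} 1 : Grass F) := by
  have hd : ({i, j} : Finset (Fin 6)) \ {i} = {j} := by
    ext k; simp only [Finset.mem_sdiff, Finset.mem_insert, Finset.mem_singleton]; grind
  funext K
  rw [mul_apply]
  by_cases hK : K = {i, j}
  · subst hK
    rw [Finset.sum_eq_single {i}]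
    · rw [hd]
      simp [xi, mono, ← Int.cast_smul_eq_zsmul F]
    · intro I _ hI
      simp [xi, mono, Pi.single_eq_of_ne hI]
    · simp
  · rw [Pi.smul_apply, mono, Pi.single_eq_of_ne hK, smul_zero]
    refine Finset.sum_eq_zero fun I hI => ?_
    rcases eq_or_ne I {i} with rfl | h
    · have : K \ {i} ≠ {j} := by
        intro h
        apply hK
        rw [← Finset.union_sdiff_of_subset (Finset.mem_powerset.mp hI), h]
        rfl
      simp [xi, mono, Pi.single_eq_of_ne this]
    · simp [xi, mono, Pi.single_eq_of_ne h]

theorem mono_pair {i j : Fin 6} (hij : i ≠ j) :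
    (mono {i, j} 1 : Grass F) = (sgn {i} {j} : F) • mul (xi i) (xi j) := by
  rw [mul_xi_xi hij, smul_smul, ← Int.cast_mul, sgn_mul_self, Int.cast_one, one_smul]

/-- `2n + |I| = 1` has only the solution `n = 0`, `|I| = 1`. -/
theorem degPart_neg_one_le :
    (degPart (-1) : Submodule F (Grass F)) ≤
      Submodule.span F (Set.range fun i : Fin 6 => Grass.xi i) := by
  intro f hf
  rw [← sum_mono f]
  refine sum_mem fun I _ => ?_
  by_cases hI : I.card = 1
  · obtain ⟨i, rfl⟩ := Finset.card_eq_one.mp hI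
    have : f {i} = PowerSeries.C (PowerSeries.coeff 0 (f {i})) := by
      ext n
      rw [PowerSeries.coeff_C]
      split_ifs with h
      · rw [h]
      · exact hf _ _ (by rw [hI]; push_cast; omega)
    rw [this, mono_C]
    exact Submodule.smul_mem _ _ (Submodule.subset_span ⟨i, rfl⟩)
  · have : f I = 0 := by
      ext n
      exact hf _ _ (by omega)
    rw [this]
    simp [mono]

/-- `2n + |I| = 2` leaves `n = 0`, `|I| = 2` and `n = 1`, `I = ∅`. -/
theorem degPart_zero_le :
    (degPart 0 : Submodule F (Grass F)) ≤
      Submodule.span F ({Grass.mono ∅ PowerSeries.X} ∪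
        {f | ∃ i j : Fin 6, i ≠ j ∧ f = Grass.mul (Grass.xi i) (Grass.xi j)}) := by
  intro f hf
  rw [← sum_mono f]
  refine sum_mem fun I _ => ?_
  by_cases hI : I.card = 2
  · obtain ⟨i, j, hij, rfl⟩ := Finset.card_eq_two.mp hI
    have : f {i, j} = PowerSeries.C (PowerSeries.coeff 0 (f {i, j})) := by
      ext n
      rw [PowerSeries.coeff_C]
      split_ifs with h
      · rw [h]
      · exact hf _ _ (by rw [hI]; push_cast; omega)
    rw [this, mono_C, mono_pair hij]
    exact Submodule.smul_mem _ _ (Submodule.smul_mem _ _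
      (Submodule.subset_span (Or.inr ⟨i, j, hij, rfl⟩)))
  · by_cases hI0 : I = ∅
    · subst hI0
      have : f ∅ = PowerSeries.coeff 1 (f ∅) • PowerSeries.X := by
        ext n
        rw [PowerSeries.coeff_smul, PowerSeries.coeff_X]
        split_ifs with h
        · rw [h]; simp
        · rw [smul_zero]; exact hf _ _ (by rw [Finset.card_empty]; push_cast; omega)
      rw [this, mono_smul]
      exact Submodule.smul_mem _ _ (Submodule.subset_span (Or.inl rfl))
    · have : f I = 0 := by
        have := Finset.card_ne_zero.mpr (Finset.nonempty_iff_ne_empty.mpr hI0)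
        ext n
        exact hf _ _ (by omega)
      rw [this]
      simp [mono]

end Grass

/-- In the degrees concerned `L` contains all of the component of `K(1,6)`, so the span can be
computed in the ambient space. -/
theorem ContactSub.map_component_eq_span {F : Type*} [Field F] {L : ContactSub F} {j : ℤ}
    {S : Set (Grass F)} (hle : Grass.degPart j ≤ Submodule.span F S)
    (hS : ∀ f ∈ S, f ∈ L.toSubmodule ∧ f ∈ Grass.degPart j) :
    (L.component j).map L.toSubmodule.subtype = Submodule.span F S := by
  refine le_antisymm ?_ (Submodule.span_le.mpr fun f hf => ?_)
  · rintro _ ⟨f, hf, rfl⟩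
    exact hle hf
  · exact ⟨⟨f, (hS f hf).1⟩, (hS f hf).2, rfl⟩

/-! ### Both forms of `E(1,6)` and the conclusion -/

theorem E16_or_poly_facts {F : Type*} [Field F] [CharZero F] {ι : F} {hι : ι ^ 2 = -1}
    {L : ContactSub F} (hL : L = E16 ι hι ∨ L = E16Poly ι hι) :
    L.toSubmodule ≤ Grass.E16Space ι ∧
    (∀ I a, I.card < 3 → (PowerSeries.derivative F)^[3 - I.card] a = 0 →
      a ∈ (Polynomial.coeToPowerSeries.ringHom (R := F)).range →
      Grass.mono I a ∈ L.toSubmodule) ∧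
    ∀ f ∈ L.toSubmodule, ∃ g ∈ L.toSubmodule, Grass.dx g = f := by
  rcases hL with rfl | rfl
  · refine ⟨le_rfl, fun I a hI ha _ => Grass.mono_mem_E16Space hI ha, fun f hf => ?_⟩
    obtain ⟨g, hg, h, -⟩ := Grass.exists_dx_eq hf
    exact ⟨g, hg, h⟩
  · refine ⟨inf_le_left, fun I a hI ha hp =>
      ⟨Grass.mono_mem_E16Space hI ha, Grass.mono_mem_polyPart hp⟩, fun f hf => ?_⟩
    obtain ⟨g, hg, h, hp⟩ := Grass.exists_dx_eq hf.1
    exact ⟨g, ⟨hg, hp hf.2⟩, h⟩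

theorem mainTheorem4 {F : Type*} [Field F] [IsAlgClosed F] [CharZero F] (ι : F) (hι : ι ^ 2 = -1)
    (L : ContactSub F) (hL : L = E16 ι hι ∨ L = E16Poly ι hι)
    (σ : L.toSubmodule →ₗ[F] L.toSubmodule) (hσ₀ : σ ≠ 0)
    (hσ : IsHomLieSuperalgebra L.parity L.lie σ) :
    ((L.component (-1)).map L.toSubmodule.subtype =
        Submodule.span F (Set.range fun i : Fin 6 => Grass.xi i) ∧
      ∀ v ∈ L.component (-1), σ v = v) ∧
    ((L.component 0).map L.toSubmodule.subtype =
        Submodule.span F ({Grass.mono ∅ PowerSeries.X} ∪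
          {f | ∃ i j : Fin 6, i ≠ j ∧ f = Grass.mul (Grass.xi i) (Grass.xi j)}) ∧
      ∀ v ∈ L.component 0, σ v = v) := by
  obtain ⟨hE, hmem, hdx⟩ := E16_or_poly_facts hL
  have hmem1 : ∀ I : Finset (Fin 6), I.card < 3 → Grass.mono I 1 ∈ L.toSubmodule := fun I hI =>
    hmem I 1 hI (by
      rw [show 3 - I.card = (2 - I.card) + 1 by omega, Function.iterate_succ_apply]
      simp [iterate_map_zero]) (one_mem _)
  have h1 := hmem1 ∅ (by simp)
  have hX : Grass.mono ∅ PowerSeries.X ∈ L.toSubmodule :=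
    hmem ∅ _ (by simp) (by simp [Function.iterate_succ_apply]) ⟨Polynomial.X, by simp⟩
  have hξ : ∀ i, Grass.xi i ∈ L.toSubmodule := fun i => hmem1 {i} (by simp)
  have hsurj : ∀ y, ∃ z, L.lie ⟨Grass.mono ∅ 1, h1⟩ z = y := by
    rintro ⟨y, hy⟩
    obtain ⟨z, hz, rfl⟩ := hdx y hy
    -- The factor `1/2` compensates for `[1, ·] = 2∂ₓ`.
    refine ⟨(2 : F)⁻¹ • ⟨z, hz⟩, Subtype.ext ?_⟩
    rw [map_smul, Submodule.coe_smul, ContactSub.lie_coe, Grass.bracket_one_left, smul_smul,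
      inv_mul_cancel₀ two_ne_zero, one_smul]
  have hid := ContactSub.map_eq_self hE hσ hσ₀ h1 hX hξ hsurj
  refine ⟨⟨?_, fun v _ => hid v⟩, ?_, fun v _ => hid v⟩
  · refine ContactSub.map_component_eq_span Grass.degPart_neg_one_le ?_
    rintro _ ⟨i, rfl⟩
    refine ⟨hξ i, ?_⟩
    have := Grass.mono_mem_degPart (F := F) {i} 0
    simpa [Grass.xi] using this
  · refine ContactSub.map_component_eq_span Grass.degPart_zero_le ?_
    rintro _ (rfl | ⟨i, j, hij, rfl⟩)
    · refine ⟨hX, ?_⟩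
      have := Grass.mono_mem_degPart (F := F) ∅ 1
      simpa using this
    · rw [Grass.mul_xi_xi hij]
      have hcard := Finset.card_pair hij
      refine ⟨Submodule.smul_mem _ _ (hmem1 _ (by omega)), Submodule.smul_mem _ _ ?_⟩
      have := Grass.mono_mem_degPart (F := F) {i, j} 0
      rw [hcard] at this
      simpa using this
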